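/- Theorem 6.1. Let $F$ be a field, let $A$ be a finite-dimensional (associative, unital) $F$-algebra, and let $R$ be a central simple subalgebra of $A$, i.e. an $F$-subalgebra containing the unity of $A$ which is a simple ring and whose center is $F\cdot 1$. Then every (unital) $F$-algebra homomorphism $\varphi : R \to A$ extends to an inner automorphism of $A$: there is an invertible element $c \in A$ such that $\varphi(x) = c x c^{-1}$ for all $x \in R$. -/

import Mathlib

open TensorProduct MulOpposite

/-! It suffices to find a unit `c` with `φ r * c = c * ψ r`, where `ψ` is the inclusion. If `A` is
simple, so is `R ⊗ Aᵐᵒᵖ`; it acts on `A` through `φ` and through `ψ`, equal dimension makes the two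
modules isomorphic, and an isomorphism commuting with right multiplications is left multiplication
by a unit. Semisimple `A` is handled factor by factor. In general, solve modulo the Jacobson
radical, lift the solution to any `c`, and average: for a separability element `∑ aᵢ ⊗ bᵢ`, the sum
`∑ φ aᵢ * c * ψ bᵢ` intertwines exactly and is unchanged modulo the radical, hence a unit. -/

/-- A simple algebra is a simple module over its multiplication algebra. -/
theorem isSimpleModule_range_mulLeftRight (F R : Type*) [Field F] [Ring R] [Algebra F R]
    [IsSimpleRing R] : IsSimpleModule (AlgHom.mulLeftRight F R).range R where
  exists_pair_ne := ⟨⊥, ⊤, bot_ne_top⟩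
  eq_bot_or_eq_top N := by
    have key : ∀ a b x : R, x ∈ N → a * x * b ∈ N := fun a b x hx ↦ by
      simpa [Subalgebra.smul_def] using
        N.smul_mem (⟨AlgHom.mulLeftRight F R (a ⊗ₜ op b), ⟨_, rfl⟩⟩ :
          (AlgHom.mulLeftRight F R).range) hx
    let I : TwoSidedIdeal R := .mk' N N.zero_mem N.add_mem
      (fun {x} hx ↦ by simpa using! key (-1) 1 x hx)
      (fun {x y} hy ↦ by simpa using key x 1 y hy) (fun {x y} hx ↦ by simpa using key 1 y x hx)
    have hI : ∀ x, x ∈ I ↔ x ∈ N := fun x ↦ by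
      simp only [I, TwoSidedIdeal.mem_mk', SetLike.mem_coe]
    refine (eq_bot_or_eq_top I).imp (fun h ↦ ?_) (fun h ↦ ?_)
    · refine (Submodule.eq_bot_iff _).2 fun x hx ↦ ?_
      rw [← hI, h] at hx
      simpa using hx
    · refine eq_top_iff.2 fun x _ ↦ ?_
      rw [← hI, h]
      trivial

/-- Every linear endomorphism of a central simple algebra is a sum of two-sided multiplications. -/
theorem mulLeftRight_surjective (F R : Type*) [Field F] [Ring R] [Algebra F R]
    [FiniteDimensional F R] [Algebra.IsCentral F R] [IsSimpleRing R] :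
    Function.Surjective (AlgHom.mulLeftRight F R) := by
  intro g
  have := isSimpleModule_range_mulLeftRight F R
  have key : ∀ (f : Module.End (AlgHom.mulLeftRight F R).range R) (a b x : R),
      f (a * x * b) = a * f x * b := fun f a b x ↦ by
    simpa [Subalgebra.smul_def] using
      f.map_smul (⟨AlgHom.mulLeftRight F R (a ⊗ₜ op b), ⟨_, rfl⟩⟩ :
        (AlgHom.mulLeftRight F R).range) x
  have hscalar : ∀ f : Module.End (AlgHom.mulLeftRight F R).range R,
      ∃ c : F, ∀ x, f x = c • x := fun f ↦ by
    have hl : ∀ x, f x = x * f 1 := fun x ↦ by simpa using key f x 1 1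
    have hr : ∀ x, f x = f 1 * x := fun x ↦ by simpa using key f 1 x 1
    obtain ⟨c, hc⟩ := (Algebra.IsCentral.mem_center_iff F (x := f 1)).1
      (Subalgebra.mem_center_iff.2 fun x ↦ by rw [← hl, ← hr])
    exact ⟨c, fun x ↦ by rw [hr, hc, Algebra.smul_def]⟩
  -- Endomorphisms over the multiplication algebra are scalars, so any `F`-linear `g` commutes with
  -- them and the density theorem applies.
  let g' : Module.End (Module.End (AlgHom.mulLeftRight F R).range R) R :=
    { toFun := g
      map_add' := map_add g
      map_smul' := fun f x ↦ by
        obtain ⟨c, hc⟩ := hscalar f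
        simp [hc] }
  obtain ⟨s, hs⟩ := Module.Finite.fg_top (R := F) (M := R)
  obtain ⟨⟨_, t, rfl⟩, ht⟩ :=
    jacobson_density (R := (AlgHom.mulLeftRight F R).range) (M := R) g' s
  refine ⟨t, LinearMap.ext_on (s := (s : Set R)) hs fun x hx ↦ ?_⟩
  simpa [Subalgebra.smul_def, g'] using (ht x hx).symm

/-- Both sides have dimension `(dim R)²`. Injectivity lets identities in `R ⊗ Rᵐᵒᵖ` be checked on
endomorphisms. -/
theorem mulLeftRight_bijective (F R : Type*) [Field F] [Ring R] [Algebra F R]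
    [FiniteDimensional F R] [Algebra.IsCentral F R] [IsSimpleRing R] :
    Function.Bijective (AlgHom.mulLeftRight F R) := by
  have hs := mulLeftRight_surjective F R
  refine ⟨(LinearMap.injective_iff_surjective_of_finrank_eq_finrank
    (f := (AlgHom.mulLeftRight F R).toLinearMap) ?_).2 hs, hs⟩
  rw [Module.finrank_tensorProduct, Module.finrank_linearMap,
    (opLinearEquiv F : R ≃ₗ[F] Rᵐᵒᵖ).finrank_eq]

/-- A separability idempotent of a central simple algebra. -/
theorem exists_separability_element (F R : Type*) [Field F] [Ring R] [Algebra F R]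
    [FiniteDimensional F R] [Algebra.IsCentral F R] [IsSimpleRing R] :
    ∃ e : R ⊗[F] Rᵐᵒᵖ, AlgHom.mulLeftRight F R e 1 = 1 ∧
      ∀ r : R, (r ⊗ₜ 1) * e = (1 ⊗ₜ op r) * e := by
  obtain ⟨f, hf⟩ := Module.Projective.exists_dual_ne_zero F (one_ne_zero (α := R))
  -- `e` acts as a projection onto the scalars `F · 1`, on which left and right multiplication by
  -- `r` agree.
  obtain ⟨e, he⟩ := mulLeftRight_surjective F R
    ((LinearMap.toSpanSingleton F R 1).comp ((f 1)⁻¹ • f))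
  refine ⟨e, by simp [he, hf], fun r ↦ (mulLeftRight_bijective F R).1 ?_⟩
  ext x
  simp [he]

/-- The tensor product of a central simple algebra and a simple algebra is simple. -/
theorem isSimpleRing_tensorProduct (F R S : Type*) [Field F] [Ring R] [Algebra F R]
    [FiniteDimensional F R] [Algebra.IsCentral F R] [IsSimpleRing R] [Ring S] [Algebra F S]
    [IsSimpleRing S] : IsSimpleRing (R ⊗[F] S) := by
  have : Nontrivial (R ⊗[F] S) :=
    (Algebra.TensorProduct.includeRight_injective (R := F) (A := R) (B := S)
      (algebraMap F R).injective).nontrivial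
  refine .of_eq_bot_or_eq_top fun I ↦ or_iff_not_imp_left.2 fun hI ↦ ?_
  have hmul : ∀ (t : R ⊗[F] Rᵐᵒᵖ) (x : R ⊗[F] S), x ∈ I →
      (AlgHom.mulLeftRight F R t).rTensor S x ∈ I := fun t x hx ↦ by
    induction t with
    | zero => simp
    | add a b ha hb => simpa [LinearMap.rTensor_add] using I.add_mem ha hb
    | tmul a b =>
      have (x : R ⊗[F] S) :
          (AlgHom.mulLeftRight F R (a ⊗ₜ b)).rTensor S x = a ⊗ₜ 1 * x * (b.unop ⊗ₜ 1) := by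
        induction x with
        | zero => simp
        | add x y hx hy => simp only [map_add, mul_add, add_mul, hx, hy]
        | tmul a b => simp
      rw [this]
      exact I.mul_mem_right _ _ (I.mul_mem_left _ _ hx)
  have hend : ∀ (g : R →ₗ[F] R) (x : R ⊗[F] S), x ∈ I → g.rTensor S x ∈ I := fun g x hx ↦ by
    obtain ⟨t, rfl⟩ := mulLeftRight_surjective F R g
    exact hmul t x hx
  obtain ⟨x, hx, hx0⟩ := SetLike.exists_of_lt (bot_lt_iff_ne_bot.2 hI)
  let b := Module.finBasis F R
  -- A nonzero coordinate of `x` in a basis of `R` is extracted by a rank-one endomorphism, which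
  -- preserves `I`.
  obtain ⟨i, s, hs, his⟩ : ∃ i, ∃ s : S, s ≠ 0 ∧
      ((b.coord i).smulRight (1 : R)).rTensor S x = 1 ⊗ₜ s := by
    let e := TensorProduct.equivFinsuppOfBasisLeft (N := S) b
    have he : e x ≠ 0 := fun h ↦ hx0 (by simp [(map_eq_zero_iff e e.injective).1 h])
    obtain ⟨i, hi⟩ := Finsupp.ne_iff.1 he
    refine ⟨i, e x i, hi, ?_⟩
    clear he hi hx hx0
    induction x with
    | zero => simp
    | add x y hx hy => simp [hx, hy, tmul_add]
    | tmul r s => simp [e, smul_tmul]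
  let J : TwoSidedIdeal S := I.comap (Algebra.TensorProduct.includeRight : S →ₐ[F] R ⊗[F] S)
  have : (1 : S) ∈ J := IsSimpleRing.one_mem_of_ne_zero_mem J hs <| by
    simpa [J, TwoSidedIdeal.mem_comap, ← his] using hend _ x hx
  rw [← I.one_mem_iff]
  simpa [J, TwoSidedIdeal.mem_comap, Algebra.TensorProduct.one_def] using this

/-- Over a simple Artinian ring there is only one simple module up to isomorphism. -/
theorem isIsotypicOfType_of_isSimpleRing {B : Type*} [Ring B] [IsSimpleRing B] [IsArtinianRing B]
    (S : Ideal B) [IsSimpleModule B S] (M : Type*) [AddCommGroup M] [Module B M] :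
    IsIsotypicOfType B M S := fun m _ ↦ by
  obtain ⟨I, ⟨e⟩⟩ := IsSemisimpleRing.exists_linearEquiv_ideal_of_isSimpleModule B m
  have := IsSimpleModule.congr e.symm
  exact ⟨e.trans (IsSimpleRing.isIsotypic B B S I).some⟩

/-- Modules of the same dimension over a finite-dimensional simple algebra are isomorphic. -/
theorem exists_linearEquiv_smul_of_finrank_eq (F : Type*) {B M N : Type*} [Field F] [Ring B]
    [Algebra F B] [FiniteDimensional F B] [IsSimpleRing B] [AddCommGroup M] [Module F M]
    [Module B M] [IsScalarTower F B M] [AddCommGroup N] [Module F N] [Module B N]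
    [IsScalarTower F B N] [FiniteDimensional F M] [FiniteDimensional F N]
    (h : Module.finrank F M = Module.finrank F N) : ∃ u : M ≃ₗ[F] N, ∀ (b : B) (x : M), u (b • x) = b • u x := by
  have : IsArtinianRing B := IsArtinianRing.of_finite F B
  have : Module.Finite B M := .of_restrictScalars_finite F B M
  have : Module.Finite B N := .of_restrictScalars_finite F B N
  obtain ⟨S, hS⟩ := IsAtomic.exists_atom (Ideal B)
  have : IsSimpleModule B S := isSimpleModule_iff_isAtom.2 hS
  obtain ⟨m, ⟨eM⟩⟩ := (isIsotypicOfType_of_isSimpleRing S M).linearEquiv_fun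
  obtain ⟨n, ⟨eN⟩⟩ := (isIsotypicOfType_of_isSimpleRing S N).linearEquiv_fun
  have : FiniteDimensional F S := .of_injective (S.subtype.restrictScalars F) S.subtype_injective
  have := IsSimpleModule.nontrivial B S
  rw [(eM.restrictScalars F).finrank_eq, (eN.restrictScalars F).finrank_eq,
    Module.finrank_pi_fintype, Module.finrank_pi_fintype] at h
  obtain rfl : m = n := by simpa [Module.finrank_pos (R := F) (M := S) |>.ne'] using h
  exact ⟨(eM.trans eN.symm).restrictScalars F, (eM.trans eN.symm).map_smul⟩

/-- Representations of a finite-dimensional simple algebra on the same space are equivalent. -/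
theorem exists_linearEquiv_intertwining {F B V : Type*} [Field F] [Ring B] [Algebra F B]
    [FiniteDimensional F B] [IsSimpleRing B] [AddCommGroup V] [Module F V] [FiniteDimensional F V]
    (ρ σ : B →ₐ[F] Module.End F V) :
    ∃ u : V ≃ₗ[F] V, ∀ b v, u (ρ b v) = σ b (u v) := by
  let i₁ : Module B V := Module.compHom V ρ.toRingHom
  let i₂ : Module B V := Module.compHom V σ.toRingHom
  have t₁ : @IsScalarTower F B V _ i₁.toSMul _ :=
    @IsScalarTower.mk _ _ _ _ i₁.toSMul _ fun c b v ↦ congr($(map_smul ρ c b) v)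
  have t₂ : @IsScalarTower F B V _ i₂.toSMul _ :=
    @IsScalarTower.mk _ _ _ _ i₂.toSMul _ fun c b v ↦ congr($(map_smul σ c b) v)
  exact @exists_linearEquiv_smul_of_finrank_eq F B V V _ _ _ _ _ _ _ i₁ t₁ _ _ i₂ t₂ _ _ rfl

/-- Two homomorphisms from a central simple algebra to a simple algebra are conjugate. -/
theorem exists_unit_intertwining_of_isSimpleRing {F R A : Type*} [Field F] [Ring R] [Algebra F R]
    [FiniteDimensional F R] [Algebra.IsCentral F R] [IsSimpleRing R] [Ring A] [Algebra F A]
    [FiniteDimensional F A] [IsSimpleRing A] (φ ψ : R →ₐ[F] A) :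
    ∃ c : Aˣ, ∀ r, φ r * c = c * ψ r := by
  have := isSimpleRing_tensorProduct F R Aᵐᵒᵖ
  have : IsArtinianRing A := IsArtinianRing.of_finite F A
  obtain ⟨u, hu⟩ := exists_linearEquiv_intertwining
    ((AlgHom.mulLeftRight F A).comp (Algebra.TensorProduct.map ψ (.id F Aᵐᵒᵖ)))
    ((AlgHom.mulLeftRight F A).comp (Algebra.TensorProduct.map φ (.id F Aᵐᵒᵖ)))
  -- The `Aᵐᵒᵖ` factor forces `u` to be left multiplication by `u 1`.
  have hr : ∀ x, u x = u 1 * x := fun x ↦ by simpa using hu (1 ⊗ₜ op x) 1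
  have hl : ∀ r, u (ψ r) = φ r * u 1 := fun r ↦ by simpa using hu (r ⊗ₜ 1) 1
  obtain ⟨y, hy⟩ := u.surjective 1
  rw [hr] at hy
  exact ⟨⟨u 1, y, hy, mul_eq_one_symm hy⟩, fun r ↦ by rw [← hl, hr]⟩

/-- Two homomorphisms from a central simple algebra to a semisimple algebra are conjugate. -/
theorem exists_unit_intertwining_of_isSemisimpleRing {F R A : Type*} [Field F] [Ring R]
    [Algebra F R] [FiniteDimensional F R] [Algebra.IsCentral F R] [IsSimpleRing R] [Ring A]
    [Algebra F A] [FiniteDimensional F A] [IsSemisimpleRing A] (φ ψ : R →ₐ[F] A) :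
    ∃ c : Aˣ, ∀ r, φ r * c = c * ψ r := by
  obtain ⟨n, D, d, _, _, _, _, ⟨e⟩⟩ :=
    IsSemisimpleRing.exists_algEquiv_pi_matrix_divisionRing_finite F A
  choose c hc using fun i ↦ exists_unit_intertwining_of_isSimpleRing
    ((Pi.evalAlgHom F _ i).comp (e.toAlgHom.comp φ))
    ((Pi.evalAlgHom F _ i).comp (e.toAlgHom.comp ψ))
  refine ⟨Units.map e.symm.toAlgHom.toMonoidHom (MulEquiv.piUnits.symm c),
    fun r ↦ e.injective ?_⟩
  ext1 i
  simpa using hc i r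

/-- An element of an Artinian ring that is invertible modulo the Jacobson radical is invertible. -/
theorem isUnit_of_isUnit_mk_jacobson {A : Type*} [Ring A] [IsArtinianRing A] {a : A}
    (h : IsUnit (Ideal.Quotient.mk (Ring.jacobson A) a)) : IsUnit a := by
  obtain ⟨b, hb⟩ := Ideal.Quotient.mk_surjective (I := Ring.jacobson A) (h.unit⁻¹).val
  have hab : 1 - a * b ∈ Ring.jacobson A := by
    rw [← Ideal.Quotient.eq_zero_iff_mem, map_sub, map_mul, hb, map_one, IsUnit.mul_val_inv,
      sub_self]
  obtain ⟨n, hn⟩ := IsSemiprimaryRing.isNilpotent (R := A)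
  have hnil : IsNilpotent (1 - a * b) := ⟨n, by
    simpa [hn] using Ideal.pow_mem_pow hab n⟩
  have hu : IsUnit (a * b) := by simpa using hnil.isUnit_one_sub
  obtain ⟨v, hv⟩ := hu
  have h1 : a * (b * v⁻¹.val) = 1 := by rw [← mul_assoc, ← hv, Units.mul_inv]
  exact ⟨⟨a, _, h1, mul_eq_one_symm h1⟩, rfl⟩

/-- Two homomorphisms from a central simple algebra to a finite-dimensional algebra are
conjugate. -/
theorem exists_unit_intertwining {F R A : Type*} [Field F] [Ring R] [Algebra F R]
    [FiniteDimensional F R] [Algebra.IsCentral F R] [IsSimpleRing R] [Ring A] [Algebra F A]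
    [FiniteDimensional F A] (φ ψ : R →ₐ[F] A) :
    ∃ c : Aˣ, ∀ r, φ r * c = c * ψ r := by
  have : IsArtinianRing A := IsArtinianRing.of_finite F A
  let π : A →ₐ[F] A ⧸ Ring.jacobson A := Ideal.Quotient.mkₐ F _
  have hπ : Function.Surjective π := Ideal.Quotient.mk_surjective
  have : FiniteDimensional F (A ⧸ Ring.jacobson A) := .of_surjective π.toLinearMap hπ
  obtain ⟨c', hc'⟩ := exists_unit_intertwining_of_isSemisimpleRing (π.comp φ) (π.comp ψ)
  obtain ⟨c, hc⟩ := hπ c'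
  obtain ⟨e, he, hcomm⟩ := exists_separability_element F R
  let ρ : R ⊗[F] Rᵐᵒᵖ →ₐ[F] Module.End F A :=
    (AlgHom.mulLeftRight F A).comp (Algebra.TensorProduct.map φ ψ.op)
  have hρ : ∀ t, π (ρ t c) = c' * π (ψ (AlgHom.mulLeftRight F R t 1)) := fun t ↦ by
    induction t with
    | zero => simp
    | add x y hx hy => simp [hx, hy, mul_add]
    | tmul a b =>
      have := hc' a
      simp only [AlgHom.comp_apply] at this
      simp [ρ, hc, ← mul_assoc, this]
  obtain ⟨v, hv⟩ : IsUnit (ρ e c) := isUnit_of_isUnit_mk_jacobson <| by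
    change IsUnit (π _)
    simp [hρ, he]
  refine ⟨v, fun r ↦ ?_⟩
  -- Applied to `c`, `r ⊗ 1` multiplies by `φ r` on the left and `1 ⊗ op r` by `ψ r` on the right.
  simpa [ρ, hv] using congr(ρ $(hcomm r) c)

theorem theorem6p1 {F : Type*} [Field F] {A : Type*} [Ring A] [Algebra F A]
    [FiniteDimensional F A] (R : Subalgebra F A) [Algebra.IsCentral F R] [IsSimpleRing R]
    (φ : R →ₐ[F] A) :
    ∃ σ : A ≃ₐ[F] A,
      (∃ c : Aˣ, ∀ a : A, σ a = (c : A) * a * ((c⁻¹ : Aˣ) : A)) ∧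
        ∀ x : R, σ (x : A) = φ x := by
  obtain ⟨c, hc⟩ := exists_unit_intertwining φ R.val
  refine ⟨MulSemiringAction.toAlgEquiv F A (ConjAct.toConjAct c), ⟨c, fun a ↦ ?_⟩, fun x ↦ ?_⟩
  · simp [ConjAct.units_smul_def]
  · have := hc x
    simp only [Subalgebra.coe_val] at this
    simp [ConjAct.units_smul_def, ← this, mul_assoc]
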